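/- Let $L_1,\dots,L_k\in \mathrm{Mat}_d(\mathbb{R})$ be simultaneously diagonalisable over $\mathbb{C}$ into the diagonal matrices $D_1,\dots,D_k$; that is, there is an invertible complex matrix $P$ with $P^{-1}L_lP=D_l=\mathrm{diag}(\lambda_{l1},\dots,\lambda_{ld})$ for every $l=1,\dots,k$, where each $\lambda_{li}\in\mathbb{C}$. Let $\mu$ be Lebesgue measure on $\mathbb{R}^d$, and for $A\subset\mathbb{R}^d$ write $L_1A+\dots+L_kA=\{L_1a_1+\dots+L_ka_k : a_1,\dots,a_k\in A\}$. Then, for every compact $A\subset\mathbb{R}^d$, $$\mu(L_1A+\dots+L_kA)\;\ge\;\Bigl(\prod_{i=1}^d\sum_{l=1}^k|\lambda_{li}|\Bigr)\,\mu(A).$$ Moreover, equality holds for some compact $A\subset\mathbb{R}^d$ with $\mu(A)>0$. -/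

import Mathlib

open MeasureTheory
open scoped Pointwise

/-- The real matrices `L l` are simultaneously diagonalised over `ℂ`, by one invertible complex
matrix `P`, into the diagonal matrices with diagonal entries `ev l 0, …, ev l (d - 1)`. -/
def SimultaneouslyDiagonalisableInto {k d : ℕ} (L : Fin k → Matrix (Fin d) (Fin d) ℝ)
    (ev : Fin k → Fin d → ℂ) : Prop :=
  ∃ P : Matrix (Fin d) (Fin d) ℂ, IsUnit P ∧
    ∀ l, P⁻¹ * (L l).map Complex.ofReal * P = Matrix.diagonal (ev l)

/-- The Minkowski sum `L₁ A + ⋯ + L_k A` of the images of `A` under the matrices `L l`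
(the empty sum, for `k = 0`, is `{0}`). -/
def sumOfImages {k d : ℕ} (L : Fin k → Matrix (Fin d) (Fin d) ℝ) (A : Set (Fin d → ℝ)) :
    Set (Fin d → ℝ) :=
  ∑ l, (L l).mulVec '' A

/-!
The map `(x, y) ↦ P⁻¹ x + i P⁻¹ y` identifies `ℝ^d × ℝ^d` with `ℂ^d` and turns `L l × L l` into
coordinatewise multiplication by `ev l`. Applying it to `A × A` reduces the lower bound to its
square for diagonal maps of `ℂ^d`, which is proved one complex coordinate at a time. On `ℂ`,
multiplication by `c` is a similarity of ratio `‖c‖`, so by the planar Brunn–Minkowski inequality,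
if the fibres of `B` over the points `x l` all have area at least `t`, then the fibre of the sum set
over the corresponding sum of images has area at least `(∑ l, ‖c l‖)² t`. Hence the superlevel sets
of the fibre area of the sum set contain sums of images of those of `B`, and integrating over the
levels multiplies the bound for the remaining coordinates by `(∑ l, ‖c l‖)²`.

Equality holds for the polydisc `A = {x | ‖P⁻¹ x‖_∞ ≤ 1}`. The sum set is contained in `M A`, where
`M` is diagonal in the basis `P` with eigenvalues `∑ l, ‖ev l i‖`. As the `L l` are real, complex
conjugation permutes their joint eigenspaces and preserves these sums, so `M` is real and the volume
of `M A` is `|det M|` times that of `A`.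
-/

open Set
open scoped ENNReal

section LevelSets

theorem lintegral_eq_mul_lintegral_superlevel {α : Type*} [MeasurableSpace α] {μ : Measure α}
    {f : α → ℝ≥0∞} (hf : AEMeasurable f μ) (hfin : ∀ x, f x ≠ ∞) {a : ℝ≥0∞} (ha₀ : a ≠ 0)
    (ha : a ≠ ∞) :
    ∫⁻ x, f x ∂μ = a * ∫⁻ t in Ioi (0 : ℝ), μ {x | a * ENNReal.ofReal t ≤ f x} := by
  have hdiv : ∀ x, f x / a ≠ ∞ := fun x => ENNReal.div_ne_top (hfin x) ha₀
  calc ∫⁻ x, f x ∂μ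
      = a * ∫⁻ x, ENNReal.ofReal (f x / a).toReal ∂μ := by
        rw [← lintegral_const_mul' _ _ ha]
        simp_rw [fun x => ENNReal.ofReal_toReal (hdiv x), ENNReal.mul_div_cancel ha₀ ha]
    _ = a * ∫⁻ t in Ioi (0 : ℝ), μ {x | t ≤ (f x / a).toReal} := by
        rw [lintegral_eq_lintegral_meas_le μ (.of_forall fun x => ENNReal.toReal_nonneg)
          (hf.div_const a).ennreal_toReal]
    _ = a * ∫⁻ t in Ioi (0 : ℝ), μ {x | a * ENNReal.ofReal t ≤ f x} := by
        simp_rw [← ENNReal.ofReal_le_iff_le_toReal (hdiv _),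
          ENNReal.le_div_iff_mul_le (.inl ha₀) (.inl ha), mul_comm]

variable {α β : Type*} [TopologicalSpace α] [TopologicalSpace β]

theorem isCompact_preimage_prodMk [T1Space α] {X : Set (α × β)} (hX : IsCompact X) (x : α) :
    IsCompact (Prod.mk x ⁻¹' X) := by
  have : Topology.IsClosedEmbedding (Prod.mk x : β → α × β) := by
    refine ⟨isEmbedding_prodMkRight x, ?_⟩
    have : range (Prod.mk x : β → α × β) = Prod.fst ⁻¹' {x} := by ext ⟨a, b⟩; simp [eq_comm]
    exact this ▸ isClosed_singleton.preimage continuous_fst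
  exact this.isCompact_preimage hX

theorem prod_measure_eq_mul_lintegral_superlevel [T2Space α] [T2Space β]
    [SecondCountableTopologyEither α β] [MeasurableSpace α] [MeasurableSpace β]
    [BorelSpace α] [BorelSpace β] (μ : Measure α)
    (ν : Measure β) [SFinite ν] [IsFiniteMeasureOnCompacts ν] {X : Set (α × β)} (hX : IsCompact X)
    {a : ℝ≥0∞} (ha₀ : a ≠ 0) (ha : a ≠ ∞) :
    μ.prod ν X =
      a * ∫⁻ t in Ioi (0 : ℝ), μ {x | a * ENNReal.ofReal t ≤ ν (Prod.mk x ⁻¹' X)} := by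
  rw [Measure.prod_apply hX.measurableSet]
  exact lintegral_eq_mul_lintegral_superlevel
    (measurable_measure_prodMk_left hX.measurableSet).aemeasurable
    (fun x => (isCompact_preimage_prodMk hX x).measure_lt_top.ne) ha₀ ha

theorem iSup_measure_fiber_ne_zero [T2Space α] [T2Space β] [SecondCountableTopologyEither α β]
    [MeasurableSpace α] [MeasurableSpace β] [BorelSpace α] [BorelSpace β] {μ : Measure α}
    {ν : Measure β} [SFinite ν] {X : Set (α × β)} (hX : IsCompact X) (hX₀ : μ.prod ν X ≠ 0) :
    ⨆ x, ν (Prod.mk x ⁻¹' X) ≠ 0 := by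
  contrapose! hX₀
  rw [Measure.measure_prod_null hX.measurableSet]
  exact .of_forall (ENNReal.iSup_eq_zero.1 hX₀)

theorem iSup_measure_fiber_ne_top [MeasurableSpace β] (ν : Measure β) [IsFiniteMeasureOnCompacts ν]
    {X : Set (α × β)} (hX : IsCompact X) : ⨆ x, ν (Prod.mk x ⁻¹' X) ≠ ∞ :=
  ne_top_of_le_ne_top (hX.image continuous_snd).measure_lt_top.ne
    (iSup_le fun x => measure_mono fun y hy => ⟨(x, y), hy, rfl⟩)

end LevelSets

/-! ### The Brunn–Minkowski inequality in the plane -/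

section BrunnMinkowski

theorem volume_add_volume_le_of_isCompact {U V : Set ℝ} (hU : IsCompact U) (hV : IsCompact V)
    (hU' : U.Nonempty) (hV' : V.Nonempty) : volume U + volume V ≤ volume (U + V) := by
  obtain ⟨M, hM, hMax⟩ := hU.exists_isGreatest hU'
  obtain ⟨m, hm, hMin⟩ := hV.exists_isLeast hV'
  have hinter : (· + m) '' U ∩ (M + ·) '' V ⊆ {M + m} := by
    rintro _ ⟨⟨x, hx, rfl⟩, y, hy, hxy⟩
    have := hMax hx
    have := hMin hy
    simp only [mem_singleton_iff] at hxy ⊢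
    linarith
  calc volume U + volume V = volume ((· + m) '' U) + volume ((M + ·) '' V) := by simp
    _ = volume ((· + m) '' U ∪ (M + ·) '' V) :=
      (measure_union₀ (hV.image (by fun_prop)).measurableSet.nullMeasurableSet
        (measure_mono_null hinter (by simp))).symm
    _ ≤ volume (U + V) := by
      refine measure_mono (union_subset ?_ ?_)
      · exact image_subset_iff.2 fun x hx => add_mem_add hx hm
      · exact image_subset_iff.2 fun x hx => add_mem_add hM hx

theorem volume_add_volume_le_of_measurableSet {U V : Set ℝ} (hU : MeasurableSet U)
    (hV : MeasurableSet V) (hU' : U.Nonempty) (hV' : V.Nonempty) :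
    volume U + volume V ≤ volume (U + V) := by
  obtain ⟨u, hu⟩ := hU'
  obtain ⟨v, hv⟩ := hV'
  simp_rw [hU.measure_eq_iSup_isCompact, hV.measure_eq_iSup_isCompact, iSup_and']
  refine ENNReal.biSup_add_biSup_le' ⟨∅, by simp⟩ ⟨∅, by simp⟩ fun C hC D hD => ?_
  calc volume C + volume D ≤ volume (insert u C) + volume (insert v D) := by
        gcongr <;> exact subset_insert _ _
    _ ≤ volume (insert u C + insert v D) :=
      volume_add_volume_le_of_isCompact (hC.2.insert u) (hD.2.insert v) (insert_nonempty _ _)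
        (insert_nonempty _ _)
    _ ≤ volume (U + V) :=
      measure_mono (add_subset_add (insert_subset hu hC.1) (insert_subset hv hD.1))

/-- Scaling the levels by the suprema of `f` and `g` makes the two families of superlevel sets
become empty at the same level `t = 1`, so the one-dimensional inequality, which needs both
summands nonempty, applies at every level `t < 1`. -/
theorem lintegral_superlevel_add_le {f g h : ℝ → ℝ≥0∞} (hf : Measurable f) (hg : Measurable g)
    (hf₀ : ⨆ x, f x ≠ 0) (hf_top : ⨆ x, f x ≠ ∞) (hg₀ : ⨆ x, g x ≠ 0) (hg_top : ⨆ x, g x ≠ ∞)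
    (hfgh : ∀ x y, f x ≠ 0 → g y ≠ 0 → f x + g y ≤ h (x + y)) :
    (∫⁻ t in Ioi (0 : ℝ), volume {x | (⨆ x, f x) * ENNReal.ofReal t ≤ f x}) +
        ∫⁻ t in Ioi (0 : ℝ), volume {x | (⨆ x, g x) * ENNReal.ofReal t ≤ g x} ≤
      ∫⁻ t in Ioi (0 : ℝ), volume {x | ((⨆ x, f x) + ⨆ x, g x) * ENNReal.ofReal t ≤ h x} := by
  set a := ⨆ x, f x
  set b := ⨆ x, g x
  refine (le_lintegral_add _ _).trans (setLIntegral_mono_ae' measurableSet_Ioi ?_)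
  filter_upwards [volume.ae_ne 1] with t ht₁ (ht₀ : 0 < t)
  have ht : ENNReal.ofReal t ≠ 0 := by simpa using ht₀
  rcases ht₁.lt_or_gt with ht₁ | ht₁
  · have hnonempty {u : ℝ → ℝ≥0∞} (hu₀ : ⨆ x, u x ≠ 0) (hu_top : ⨆ x, u x ≠ ∞) :
        {x | (⨆ x, u x) * ENNReal.ofReal t ≤ u x}.Nonempty := by
      have hlt : (⨆ x, u x) * ENNReal.ofReal t < ⨆ x, u x := by
        simpa using (ENNReal.mul_lt_mul_iff_right hu₀ hu_top).2 (ENNReal.ofReal_lt_one.2 ht₁)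
      obtain ⟨x, hx⟩ := lt_iSup_iff.1 hlt
      exact ⟨x, hx.le⟩
    refine (volume_add_volume_le_of_measurableSet (measurableSet_le measurable_const hf)
      (measurableSet_le measurable_const hg) (hnonempty hf₀ hf_top)
      (hnonempty hg₀ hg_top)).trans (measure_mono ?_)
    rintro _ ⟨x, hx : a * _ ≤ f x, y, hy : b * _ ≤ g y, rfl⟩
    calc (a + b) * ENNReal.ofReal t ≤ f x + g y := by rw [add_mul]; gcongr
      _ ≤ h (x + y) := hfgh x y (ne_bot_of_le_ne_bot (mul_ne_zero hf₀ ht) hx)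
        (ne_bot_of_le_ne_bot (mul_ne_zero hg₀ ht) hy)
  · have hempty {u : ℝ → ℝ≥0∞} (hu₀ : ⨆ x, u x ≠ 0) (hu_top : ⨆ x, u x ≠ ∞) :
        {x | (⨆ x, u x) * ENNReal.ofReal t ≤ u x} = ∅ := by
      have hlt : ⨆ x, u x < (⨆ x, u x) * ENNReal.ofReal t := by
        simpa using (ENNReal.mul_lt_mul_iff_right hu₀ hu_top).2 (ENNReal.one_lt_ofReal.2 ht₁)
      exact eq_empty_of_forall_notMem fun x hx => (hlt.trans_le hx).not_ge (le_iSup u x)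
    rw [hempty hf₀ hf_top, hempty hg₀ hg_top]
    simp

theorem rpow_half_add_rpow_half_le (a b u v : ℝ≥0∞) :
    (a * u) ^ (1 / 2 : ℝ) + (b * v) ^ (1 / 2 : ℝ) ≤ ((a + b) * (u + v)) ^ (1 / 2 : ℝ) := by
  have h := ENNReal.inner_le_Lp_mul_Lq Finset.univ ![a ^ (1 / 2 : ℝ), b ^ (1 / 2 : ℝ)]
    ![u ^ (1 / 2 : ℝ), v ^ (1 / 2 : ℝ)] Real.HolderConjugate.two_two
  simp only [Fin.sum_univ_two, Matrix.cons_val_zero, Matrix.cons_val_one, ← ENNReal.rpow_mul,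
    one_div, inv_mul_cancel₀ (two_ne_zero (α := ℝ)), ENNReal.rpow_one] at h
  simpa only [one_div, ENNReal.mul_rpow_of_nonneg _ _ (inv_nonneg.2 zero_le_two)] using h

theorem volume_fiber_add_volume_fiber_le {X Y : Set (ℝ × ℝ)} (hX : IsCompact X)
    (hY : IsCompact Y) (x y : ℝ) (hx : volume (Prod.mk x ⁻¹' X) ≠ 0)
    (hy : volume (Prod.mk y ⁻¹' Y) ≠ 0) :
    volume (Prod.mk x ⁻¹' X) + volume (Prod.mk y ⁻¹' Y) ≤
      volume (Prod.mk (x + y) ⁻¹' (X + Y)) := by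
  refine (volume_add_volume_le_of_isCompact (isCompact_preimage_prodMk hX x)
    (isCompact_preimage_prodMk hY y) (nonempty_of_measure_ne_zero hx)
    (nonempty_of_measure_ne_zero hy)).trans (measure_mono ?_)
  rintro _ ⟨u, hu, v, hv, rfl⟩
  exact ⟨(x, u), hu, (y, v), hv, rfl⟩

theorem volume_rpow_add_volume_rpow_le_real_prod {X Y : Set (ℝ × ℝ)} (hX : IsCompact X)
    (hY : IsCompact Y) (hX' : X.Nonempty) (hY' : Y.Nonempty) :
    volume X ^ (1 / 2 : ℝ) + volume Y ^ (1 / 2 : ℝ) ≤ volume (X + Y) ^ (1 / 2 : ℝ) := by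
  obtain ⟨x₀, hx₀⟩ := hX'
  obtain ⟨y₀, hy₀⟩ := hY'
  rcases eq_or_ne (volume X) 0 with hXv | hXv
  · calc volume X ^ (1 / 2 : ℝ) + volume Y ^ (1 / 2 : ℝ) = volume ({x₀} + Y) ^ (1 / 2 : ℝ) := by
          simp [hXv]
      _ ≤ volume (X + Y) ^ (1 / 2 : ℝ) := by gcongr; simpa
  rcases eq_or_ne (volume Y) 0 with hYv | hYv
  · calc volume X ^ (1 / 2 : ℝ) + volume Y ^ (1 / 2 : ℝ) = volume (X + {y₀}) ^ (1 / 2 : ℝ) := by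
          simp [hYv]
      _ ≤ volume (X + Y) ^ (1 / 2 : ℝ) := by gcongr; simpa
  rw [Measure.volume_eq_prod] at hXv hYv ⊢
  have ha₀ := iSup_measure_fiber_ne_zero hX hXv
  have hb₀ := iSup_measure_fiber_ne_zero hY hYv
  have ha := iSup_measure_fiber_ne_top volume hX
  have hb := iSup_measure_fiber_ne_top volume hY
  have hlevel := lintegral_superlevel_add_le (h := fun x => volume (Prod.mk x ⁻¹' (X + Y)))
    (measurable_measure_prodMk_left hX.measurableSet)
    (measurable_measure_prodMk_left hY.measurableSet) ha₀ ha hb₀ hb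
    (volume_fiber_add_volume_fiber_le hX hY)
  rw [prod_measure_eq_mul_lintegral_superlevel _ _ hX ha₀ ha,
    prod_measure_eq_mul_lintegral_superlevel _ _ hY hb₀ hb,
    prod_measure_eq_mul_lintegral_superlevel _ _ (hX.add hY)
      (add_ne_zero.2 (.inl ha₀)) (ENNReal.add_ne_top.2 ⟨ha, hb⟩)]
  refine (rpow_half_add_rpow_half_le _ _ _ _).trans ?_
  gcongr

end BrunnMinkowski

/-! ### Expansion of compact sets -/

section SumExpands

variable {κ E F : Type*} [Fintype κ]

theorem isCompact_sum [AddCommMonoid E] [TopologicalSpace E] [ContinuousAdd E] {A : κ → Set E}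
    (hA : ∀ l, IsCompact (A l)) : IsCompact (∑ l, A l) := by
  rw [← Set.image_fintype_sum_pi]
  exact (isCompact_univ_pi hA).image (by fun_prop)

/-- Expansion of compact sets by a family of maps: the Minkowski sum of the images of a compact set
under all the maps `T l` has at least `K` times the measure of the set. -/
def SumExpands [AddCommMonoid E] [TopologicalSpace E] [MeasurableSpace E] (μ : Measure E)
    (T : κ → E → E) (K : ℝ≥0∞) : Prop :=
  ∀ A : Set E, IsCompact A → K * μ A ≤ μ (∑ l, T l '' A)

/-- The strengthening of `SumExpands` in which every map is applied to a compact set of its own and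
`K` multiplies the least of their measures. It lets expansion pass to products, since the fibres
of one set over different points are different sets. For empty `κ` the infimum is `∞`. -/
def SumExpandsFamilies [AddCommMonoid E] [TopologicalSpace E] [MeasurableSpace E] (μ : Measure E)
    (T : κ → E → E) (K : ℝ≥0∞) : Prop :=
  ∀ A : κ → Set E, (∀ l, IsCompact (A l)) → K * ⨅ l, μ (A l) ≤ μ (∑ l, T l '' A l)

theorem SumExpands.le_of_measurableSet [AddCommMonoid E] [TopologicalSpace E] [MeasurableSpace E]
    {μ : Measure E} [μ.InnerRegular] {T : κ → E → E} {K : ℝ≥0∞} (h : SumExpands μ T K) {A : Set E}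
    (hA : MeasurableSet A) : K * μ A ≤ μ (∑ l, T l '' A) := by
  simp only [hA.measure_eq_iSup_isCompact μ, ENNReal.mul_iSup, iSup_le_iff]
  exact fun C hCA hC => (h C hC).trans <|
    measure_mono <| Set.finsetSum_subset_finsetSum _ _ _ fun l _ => image_mono hCA

theorem sum_image_fiber_subset [AddCommMonoid E] [AddCommMonoid F] (S : κ → E → E) (T : κ → F → F)
    (A : Set (E × F)) (x : κ → E) :
    ∑ l, T l '' (Prod.mk (x l) ⁻¹' A) ⊆
      Prod.mk (∑ l, S l (x l)) ⁻¹' ∑ l, Prod.map (S l) (T l) '' A := by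
  intro w hw
  obtain ⟨g, hg, rfl⟩ := (mem_fintype_sum _ _).1 hw
  choose y hy hyg using hg
  refine (mem_fintype_sum _ _).2
    ⟨fun l => (S l (x l), T l (y l)), fun l => ⟨(x l, y l), hy l, rfl⟩, ?_⟩
  simp [Prod.ext_iff, Prod.fst_sum, Prod.snd_sum, hyg]

theorem SumExpands.prodMap
    [AddCommMonoid E] [TopologicalSpace E] [ContinuousAdd E] [T2Space E] [MeasurableSpace E]
    [BorelSpace E] [AddCommMonoid F] [TopologicalSpace F] [ContinuousAdd F] [T2Space F]
    [MeasurableSpace F] [BorelSpace F] [SecondCountableTopologyEither E F]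
    {μ : Measure E} [μ.InnerRegular] {ν : Measure F} [SFinite ν] [IsFiniteMeasureOnCompacts ν]
    {S : κ → E → E} {T : κ → F → F} {K K' : ℝ≥0∞} (hK' : K' ≠ ∞)
    (hScont : ∀ l, Continuous (S l)) (hTcont : ∀ l, Continuous (T l))
    (hS : SumExpands μ S K) (hT : SumExpandsFamilies ν T K') :
    SumExpands (μ.prod ν) (fun l => Prod.map (S l) (T l)) (K' * K) := by
  intro A hA
  rcases eq_or_ne K' 0 with rfl | hK'₀
  · simp
  set C := ∑ l, Prod.map (S l) (T l) '' A
  have hC : IsCompact C := isCompact_sum fun l => hA.image ((hScont l).prodMap (hTcont l))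
  have hlevel (t : ℝ) : K * μ {x | ENNReal.ofReal t ≤ ν (Prod.mk x ⁻¹' A)} ≤
      μ {x | K' * ENNReal.ofReal t ≤ ν (Prod.mk x ⁻¹' C)} := by
    refine (hS.le_of_measurableSet (measurableSet_le measurable_const
      (measurable_measure_prodMk_left hA.measurableSet))).trans (measure_mono fun y hy => ?_)
    obtain ⟨g, hg, rfl⟩ := (mem_fintype_sum _ _).1 hy
    choose x hx hxg using hg
    obtain rfl : (fun l => S l (x l)) = g := funext hxg
    calc K' * ENNReal.ofReal t ≤ K' * ⨅ l, ν (Prod.mk (x l) ⁻¹' A) := by gcongr; exact le_iInf hx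
      _ ≤ ν (∑ l, T l '' (Prod.mk (x l) ⁻¹' A)) :=
        hT _ fun l => isCompact_preimage_prodMk hA (x l)
      _ ≤ ν (Prod.mk (∑ l, S l (x l)) ⁻¹' C) := measure_mono (sum_image_fiber_subset S T A x)
  calc K' * K * μ.prod ν A
      = K' * (K * ∫⁻ t in Ioi (0 : ℝ), μ {x | ENNReal.ofReal t ≤ ν (Prod.mk x ⁻¹' A)}) := by
        rw [prod_measure_eq_mul_lintegral_superlevel μ ν hA one_ne_zero ENNReal.one_ne_top,
          mul_assoc]
        simp only [one_mul]
    _ ≤ K' * ∫⁻ t in Ioi (0 : ℝ), μ {x | K' * ENNReal.ofReal t ≤ ν (Prod.mk x ⁻¹' C)} := by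
        gcongr
        exact (lintegral_const_mul_le _ _).trans (lintegral_mono hlevel)
    _ = μ.prod ν C := (prod_measure_eq_mul_lintegral_superlevel μ ν hC hK'₀ hK').symm

theorem SumExpands.of_prodMap_self [AddCommMonoid E] [TopologicalSpace E] [MeasurableSpace E]
    {μ : Measure E} [SFinite μ] {T : κ → E → E} {K : ℝ≥0∞}
    (h : SumExpands (μ.prod μ) (fun l => Prod.map (T l) (T l)) (K ^ 2)) : SumExpands μ T K := by
  intro A hA
  have hsum : ∑ l, Prod.map (T l) (T l) '' A ×ˢ A ⊆ (∑ l, T l '' A) ×ˢ ∑ l, T l '' A := by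
    intro y hy
    obtain ⟨g, hg, rfl⟩ := (mem_fintype_sum _ _).1 hy
    simp only [prodMap_image_prod] at hg
    rw [mem_prod, Prod.fst_sum, Prod.snd_sum]
    exact ⟨finsetSum_mem_finsetSum _ _ _ fun l _ => (hg l).1,
      finsetSum_mem_finsetSum _ _ _ fun l _ => (hg l).2⟩
  have hsq := (h _ (hA.prod hA)).trans (measure_mono hsum)
  rw [Measure.prod_prod, Measure.prod_prod, ← sq, ← sq, ← mul_pow] at hsq
  exact (ENNReal.pow_le_pow_left_iff two_ne_zero).1 hsq

theorem SumExpands.of_linearEquiv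
    [NormedAddCommGroup E] [NormedSpace ℝ E] [FiniteDimensional ℝ E] [MeasurableSpace E]
    [BorelSpace E] [NormedAddCommGroup F] [NormedSpace ℝ F] [MeasurableSpace F] [BorelSpace F]
    {μ : Measure E} [μ.IsAddHaarMeasure] {ν : Measure F} [ν.IsAddHaarMeasure]
    {S : κ → E → E} {T : κ → F → F} {K : ℝ≥0∞} (h : SumExpands ν T K) (e : E ≃ₗ[ℝ] F)
    (he : ∀ l x, e (S l x) = T l (e x)) : SumExpands μ S K := by
  have := Module.Finite.equiv e
  let e' := e.toContinuousLinearEquiv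
  have := e'.isAddHaarMeasure_map μ
  have hc (A : Set E) : μ A = (μ.map e').addHaarScalarFactor ν * ν (e '' A) := by
    calc μ A = μ.map e' (e '' A) := by
          conv_lhs => rw [← preimage_image_eq A e.injective]
          exact (e'.toHomeomorph.toMeasurableEquiv.map_apply _).symm
      _ = (μ.map e').addHaarScalarFactor ν * ν (e '' A) := by
        conv_lhs => rw [Measure.isAddLeftInvariant_eq_smul (μ.map e') ν]
        rfl
  intro A hA
  have hsum : e '' ∑ l, S l '' A = ∑ l, T l '' (e '' A) := by
    rw [image_finsetSum]
    simp only [image_image, he]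
  rw [hc, hc, hsum, mul_left_comm]
  gcongr
  exact h _ (hA.image e'.continuous)

end SumExpands

section Complex

variable {κ : Type*}

theorem volume_rpow_add_volume_rpow_le_complex {X Y : Set ℂ} (hX : IsCompact X)
    (hY : IsCompact Y) (hX' : X.Nonempty) (hY' : Y.Nonempty) :
    volume X ^ (1 / 2 : ℝ) + volume Y ^ (1 / 2 : ℝ) ≤ volume (X + Y) ^ (1 / 2 : ℝ) := by
  have hvol (Z : Set ℂ) : volume (Complex.equivRealProdCLM '' Z) = volume Z := by
    rw [← Complex.volume_preserving_equiv_real_prod.measure_preimage_equiv]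
    exact congrArg volume (preimage_image_eq Z Complex.equivRealProdCLM.injective)
  have h := volume_rpow_add_volume_rpow_le_real_prod
    (hX.image Complex.equivRealProdCLM.continuous) (hY.image Complex.equivRealProdCLM.continuous)
    (hX'.image _) (hY'.image _)
  rwa [← image_add, hvol, hvol, hvol] at h

theorem sum_volume_rpow_le_complex (s : Finset κ) {X : κ → Set ℂ} (hX : ∀ l, IsCompact (X l))
    (hX' : ∀ l, (X l).Nonempty) :
    ∑ l ∈ s, volume (X l) ^ (1 / 2 : ℝ) ≤ volume (∑ l ∈ s, X l) ^ (1 / 2 : ℝ) := by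
  classical
  induction s using Finset.induction_on with
  | empty => simp
  | insert a s ha ih =>
    have hs : IsCompact (∑ l ∈ s, X l) := by
      rw [← Finset.sum_coe_sort]
      exact isCompact_sum fun l => hX l
    have hs' : (∑ l ∈ s, X l).Nonempty := by
      choose g hg using hX'
      exact ⟨_, finsetSum_mem_finsetSum s X g fun l _ => hg l⟩
    rw [Finset.sum_insert ha, Finset.sum_insert ha]
    exact (by gcongr : _ ≤ _).trans
      (volume_rpow_add_volume_rpow_le_complex (hX a) hs (hX' a) hs')

theorem volume_image_mul_left_complex (c : ℂ) (X : Set ℂ) :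
    volume ((c * ·) '' X) = ‖c‖ₑ ^ 2 * volume X := by
  have hdet : LinearMap.det (LinearMap.mul ℝ ℂ c) = ‖c‖ ^ 2 := by
    rw [← Complex.normSq_eq_norm_sq, ← Algebra.norm_complex_apply]
    rfl
  have h := Measure.addHaar_image_linearMap volume (LinearMap.mul ℝ ℂ c) X
  rwa [hdet, abs_of_nonneg (by positivity), ENNReal.ofReal_pow (norm_nonneg c), ofReal_norm] at h

theorem sumExpandsFamilies_mul_left_complex [Fintype κ] (c : κ → ℂ) :
    SumExpandsFamilies volume (fun l z => c l * z) ((∑ l, ‖c l‖ₑ) ^ 2) := by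
  intro X hX
  set m := ⨅ l, volume (X l)
  rcases eq_or_ne m 0 with hm₀ | hm₀
  · simp [hm₀]
  have hX' (l : κ) : (X l).Nonempty :=
    nonempty_of_measure_ne_zero (ne_bot_of_le_ne_bot hm₀ (iInf_le _ l))
  have hroot : (∑ l, ‖c l‖ₑ) * m ^ (1 / 2 : ℝ) ≤
      volume (∑ l, (c l * ·) '' X l) ^ (1 / 2 : ℝ) :=
    calc (∑ l, ‖c l‖ₑ) * m ^ (1 / 2 : ℝ)
        ≤ ∑ l, volume ((c l * ·) '' X l) ^ (1 / 2 : ℝ) := by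
          rw [Finset.sum_mul]
          refine Finset.sum_le_sum fun l _ => ?_
          rw [volume_image_mul_left_complex, ENNReal.mul_rpow_of_nonneg _ _ one_half_pos.le,
            ← ENNReal.rpow_natCast, ← ENNReal.rpow_mul, Nat.cast_ofNat,
            mul_one_div_cancel two_ne_zero, ENNReal.rpow_one]
          gcongr
          exact iInf_le _ l
      _ ≤ _ := sum_volume_rpow_le_complex _ (fun l => (hX l).image (by fun_prop))
          fun l => (hX' l).image _
  have hsq (x : ℝ≥0∞) : (x ^ (1 / 2 : ℝ)) ^ 2 = x := by
    rw [← ENNReal.rpow_natCast, ← ENNReal.rpow_mul]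
    simp
  simpa only [mul_pow, hsq] using pow_le_pow_left' hroot 2

end Complex

section Diagonal

variable {κ ι : Type*} [Fintype κ] [Fintype ι]

theorem sumExpands_mul_left (c : κ → ι → ℂ) :
    SumExpands volume (fun l z => c l * z) (∏ i, (∑ l, ‖c l i‖ₑ) ^ 2) := by
  revert c
  refine Fintype.induction_empty_option (P := fun ι _ => ∀ c : κ → ι → ℂ,
    SumExpands volume (fun l z => c l * z) (∏ i, (∑ l, ‖c l i‖ₑ) ^ 2)) ?_ ?_ ?_ ι
  · intro α β _ e ih c
    let := Fintype.ofEquiv β e.symm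
    rw [← Equiv.prod_comp e]
    exact (ih fun l => c l ∘ e).of_linearEquiv (LinearEquiv.funCongrLeft ℝ ℂ e) fun _ _ => rfl
  · intro c A _
    rcases A.eq_empty_or_nonempty with rfl | ⟨a, ha⟩
    · simp
    · have hmem := finsetSum_mem_finsetSum Finset.univ (fun l => (c l * ·) '' A) _
        fun l _ => mem_image_of_mem _ ha
      rw [Subsingleton.eq_univ_of_nonempty ⟨_, hmem⟩]
      simpa using measure_mono (subset_univ A)
  · intro α _ ih c
    have hnone : (∑ l, ‖c l none‖ₑ) ^ 2 ≠ ∞ :=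
      ENNReal.pow_ne_top (ENNReal.sum_ne_top.2 fun l _ => enorm_ne_top)
    have hprod := (ih fun l i => c l i).prodMap hnone (fun l => by fun_prop)
      (fun l => by fun_prop) (sumExpandsFamilies_mul_left_complex fun l => c l none)
    have : (volume.prod volume : Measure ((α → ℂ) × ℂ)).IsAddHaarMeasure :=
      Measure.prod.instIsAddHaarMeasure _ _
    rw [Fintype.prod_option]
    exact hprod.of_linearEquiv
      (LinearEquiv.piOptionEquivProd ℝ ≪≫ₗ LinearEquiv.prodComm ℝ _ _) fun _ _ => rfl

end Diagonal

/-! ### Real vectors in eigenbasis coordinates -/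

section Eigenbasis

open Matrix

variable {κ ι : Type*} [Fintype ι] [DecidableEq ι] {P : Matrix ι ι ℂ}

/-- The coordinates of a real vector with respect to the basis of `ℂ^ι` formed by the columns of
`P`. -/
noncomputable def eigenCoord (P : Matrix ι ι ℂ) : (ι → ℝ) →ₗ[ℝ] (ι → ℂ) :=
  P⁻¹.mulVecLin.restrictScalars ℝ ∘ₗ Complex.ofRealCLM.toLinearMap.compLeft ι

theorem mulVec_eigenCoord (hP : IsUnit P) (x : ι → ℝ) (i : ι) :
    (P *ᵥ eigenCoord P x) i = x i := by
  have h : P *ᵥ eigenCoord P x = P *ᵥ P⁻¹ *ᵥ fun i => (x i : ℂ) := rfl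
  rw [h, mulVec_mulVec, mul_nonsing_inv P ((isUnit_iff_isUnit_det P).1 hP), one_mulVec]

theorem eigenCoord_injective (hP : IsUnit P) : Function.Injective (eigenCoord P) := by
  intro x y hxy
  ext i
  rw [← Complex.ofReal_inj, ← mulVec_eigenCoord hP, hxy, mulVec_eigenCoord hP]

theorem eigenCoord_mulVec (hP : IsUnit P) {M : Matrix ι ι ℝ} {w : ι → ℂ}
    (hM : M.map Complex.ofReal = P * diagonal w * P⁻¹) (x : ι → ℝ) :
    eigenCoord P (M *ᵥ x) = w * eigenCoord P x := by
  have hx : (fun i => ((M *ᵥ x) i : ℂ)) = M.map Complex.ofReal *ᵥ fun i => (x i : ℂ) := by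
    ext i
    simp [mulVec, dotProduct]
  have h : eigenCoord P (M *ᵥ x) = P⁻¹ *ᵥ fun i => ((M *ᵥ x) i : ℂ) := rfl
  rw [h, hx, hM, mulVec_mulVec, ← mul_assoc, ← mul_assoc,
    nonsing_inv_mul P ((isUnit_iff_isUnit_det P).1 hP), one_mul, ← mulVec_mulVec]
  ext i
  rw [mulVec_diagonal]
  rfl

theorem exists_linearEquiv_eq_eigenCoord_add (hP : IsUnit P) :
    ∃ e : ((ι → ℝ) × (ι → ℝ)) ≃ₗ[ℝ] (ι → ℂ),
      ∀ x, e x = eigenCoord P x.1 + Complex.I • eigenCoord P x.2 := by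
  let f : ((ι → ℝ) × (ι → ℝ)) →ₗ[ℝ] (ι → ℂ) :=
    (eigenCoord P).coprod (Complex.I • eigenCoord P)
  have hf : Function.Injective f := by
    refine (injective_iff_map_eq_zero f).2 fun x hx => ?_
    have hPx (i : ι) : (x.1 i : ℂ) + Complex.I * x.2 i = 0 := by
      rw [← mulVec_eigenCoord hP, ← mulVec_eigenCoord hP]
      simpa [f, mulVec_add, mulVec_smul] using congrFun (congrArg (P *ᵥ ·) hx) i
    ext i
    · simpa using congrArg Complex.re (hPx i)
    · simpa using congrArg Complex.im (hPx i)
  have hdim : Module.finrank ℝ ((ι → ℝ) × (ι → ℝ)) = Module.finrank ℝ (ι → ℂ) := by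
    simp [Module.finrank_pi_fintype, mul_two]
  exact ⟨.ofInjectiveOfFinrankEq f hf hdim, fun x => rfl⟩

theorem sumExpands_mulVec [Fintype κ] (hP : IsUnit P) {L : κ → Matrix ι ι ℝ} {ev : κ → ι → ℂ}
    (hL : ∀ l, (L l).map Complex.ofReal = P * diagonal (ev l) * P⁻¹) :
    SumExpands volume (fun l => (L l).mulVec) (∏ i, ∑ l, ‖ev l i‖ₑ) := by
  obtain ⟨e, he⟩ := exists_linearEquiv_eq_eigenCoord_add hP
  have : (volume.prod volume : Measure ((ι → ℝ) × (ι → ℝ))).IsAddHaarMeasure :=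
    Measure.prod.instIsAddHaarMeasure _ _
  have hsq := sumExpands_mul_left ev
  rw [Finset.prod_pow] at hsq
  refine (hsq.of_linearEquiv e fun l x => ?_).of_prodMap_self
  simp only [he, Prod.map_fst, Prod.map_snd, eigenCoord_mulVec hP (hL l), mul_add, mul_smul_comm]

end Eigenbasis

/-! ### Sets attaining equality -/

theorem ofReal_prod_sum_norm {κ ι E : Type*} [Fintype κ] [Fintype ι] [SeminormedAddGroup E]
    (v : κ → ι → E) : ENNReal.ofReal (∏ i, ∑ l, ‖v l i‖) = ∏ i, ∑ l, ‖v l i‖ₑ := by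
  rw [ENNReal.ofReal_prod_of_nonneg fun i _ => Finset.sum_nonneg fun _ _ => norm_nonneg _]
  simp_rw [ENNReal.ofReal_sum_of_nonneg fun _ _ => norm_nonneg _, ofReal_norm]

section Equality

open Matrix

variable {κ ι : Type*} [Fintype ι] [DecidableEq ι]

theorem diagonal_comp_mul_eq_mul_diagonal_comp {R : Type*} [CommSemiring R] [IsCancelMulZero R]
    {u v : κ → ι → R} {M : Matrix ι ι R}
    (h : ∀ l, diagonal (u l) * M = M * diagonal (v l)) (f : (κ → R) → R) :
    diagonal (fun i => f fun l => u l i) * M = M * diagonal fun j => f fun l => v l j := by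
  ext i j
  rw [diagonal_mul, mul_diagonal, mul_comm]
  rcases eq_or_ne (M i j) 0 with hM | hM
  · rw [hM, zero_mul, zero_mul]
  · congr 2
    ext l
    refine mul_left_cancel₀ hM ?_
    have hl := congrFun (congrFun (h l) i) j
    rwa [diagonal_mul, mul_diagonal, mul_comm] at hl

theorem map_star_conj_diagonal_eq_iff {R : Type*} [CommRing R] [StarRing R] {P : Matrix ι ι R}
    (hP : IsUnit P) (w : ι → R) :
    (P * diagonal w * P⁻¹).map (starRingEnd R) = P * diagonal w * P⁻¹ ↔
      diagonal w * (P⁻¹ * P.map (starRingEnd R)) =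
        P⁻¹ * P.map (starRingEnd R) * diagonal fun i => star (w i) := by
  obtain ⟨p, rfl⟩ := hP
  obtain ⟨q, hq⟩ : ∃ q, q = Units.map (starRingEnd R).mapMatrix.toMonoidHom p := ⟨_, rfl⟩
  have hp : (p : Matrix ι ι R).map (starRingEnd R) = q := hq ▸ rfl
  have hp' : (p : Matrix ι ι R)⁻¹.map (starRingEnd R) = ↑q⁻¹ := by
    rw [← coe_units_inv, hq]
    rfl
  have hw : (diagonal w).map (starRingEnd R) = diagonal fun i => star (w i) :=
    diagonal_map (map_zero _)
  rw [Matrix.map_mul, Matrix.map_mul, hp, hp', hw, ← coe_units_inv,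
    Units.mul_inv_eq_iff_eq_mul, mul_assoc, mul_assoc, ← Units.inv_mul_eq_iff_eq_mul, ← mul_assoc,
    eq_comm]

theorem exists_real_map_ofReal_eq {P : Matrix ι ι ℂ} (hP : IsUnit P) {L : κ → Matrix ι ι ℝ}
    {ev : κ → ι → ℂ} (hL : ∀ l, (L l).map Complex.ofReal = P * diagonal (ev l) * P⁻¹)
    {f : (κ → ℂ) → ℂ} (hf : ∀ v, f (fun l => star (v l)) = star (f v)) :
    ∃ M : Matrix ι ι ℝ,
      M.map Complex.ofReal = P * diagonal (fun i => f fun l => ev l i) * P⁻¹ := by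
  have hev (l : κ) : (P * diagonal (ev l) * P⁻¹).map (starRingEnd ℂ) =
      P * diagonal (ev l) * P⁻¹ := by
    rw [← hL]
    ext i j
    exact Complex.conj_ofReal _
  -- `P⁻¹ * star P` intertwines each `diagonal (ev l)` with its conjugate, hence also any function
  -- of these diagonal matrices.
  have hfix := (map_star_conj_diagonal_eq_iff hP fun i => f fun l => ev l i).2 <| by
    simpa only [hf] using diagonal_comp_mul_eq_mul_diagonal_comp
      (fun l => (map_star_conj_diagonal_eq_iff hP (ev l)).1 (hev l)) f
  refine ⟨(P * diagonal (fun i => f fun l => ev l i) * P⁻¹).map Complex.re, ?_⟩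
  ext i j
  exact Complex.conj_eq_iff_re.1 (congrFun (congrFun hfix i) j)

/-- The real vectors all of whose coordinates with respect to the columns of `P` have modulus at
most one: the set for which the lower bound is attained. -/
def eigenPolydisc (P : Matrix ι ι ℂ) : Set (ι → ℝ) :=
  eigenCoord P ⁻¹' Metric.closedBall 0 1

theorem mem_eigenPolydisc {P : Matrix ι ι ℂ} {x : ι → ℝ} :
    x ∈ eigenPolydisc P ↔ ∀ i, ‖eigenCoord P x i‖ ≤ 1 := by
  rw [eigenPolydisc, mem_preimage, mem_closedBall_zero_iff, pi_norm_le_iff_of_nonneg zero_le_one]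

theorem isCompact_eigenPolydisc {P : Matrix ι ι ℂ} (hP : IsUnit P) :
    IsCompact (eigenPolydisc P) :=
  ((eigenCoord P).isClosedEmbedding_of_injective
    (LinearMap.ker_eq_bot.2 (eigenCoord_injective hP))).isCompact_preimage
      (isCompact_closedBall 0 1)

theorem volume_eigenPolydisc_pos (P : Matrix ι ι ℂ) : 0 < volume (eigenPolydisc P) := by
  refine Measure.measure_pos_of_mem_nhds volume (x := 0) ?_
  refine (eigenCoord P).continuous_of_finiteDimensional.continuousAt ?_
  rw [map_zero]
  exact Metric.closedBall_mem_nhds 0 one_pos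

theorem volume_image_mulVec (M : Matrix ι ι ℝ) (A : Set (ι → ℝ)) :
    volume (M.mulVec '' A) = ‖M.det‖ₑ * volume A := by
  rw [← LinearMap.det_toLin', Real.enorm_eq_ofReal_abs]
  exact Measure.addHaar_image_linearMap volume M.toLin' A

theorem det_eq_prod_of_map_ofReal_eq {P : Matrix ι ι ℂ} (hP : IsUnit P) {M : Matrix ι ι ℝ}
    {w : ι → ℂ} (hM : M.map Complex.ofReal = P * diagonal w * P⁻¹) : (M.det : ℂ) = ∏ i, w i := by
  calc (M.det : ℂ) = (M.map Complex.ofReal).det := Complex.ofRealHom.map_det M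
    _ = ∏ i, w i := by rw [hM, det_conj hP, det_diagonal]

theorem norm_eigenCoord_sum_le [Fintype κ] {P : Matrix ι ι ℂ} (hP : IsUnit P)
    {L : κ → Matrix ι ι ℝ} {ev : κ → ι → ℂ}
    (hL : ∀ l, (L l).map Complex.ofReal = P * diagonal (ev l) * P⁻¹) {y : ι → ℝ}
    (hy : y ∈ ∑ l, (L l).mulVec '' eigenPolydisc P) (i : ι) :
    ‖eigenCoord P y i‖ ≤ ∑ l, ‖ev l i‖ := by
  obtain ⟨g, hg, rfl⟩ := (mem_fintype_sum _ _).1 hy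
  choose a ha hag using hg
  calc ‖eigenCoord P (∑ l, g l) i‖ = ‖∑ l, ev l i * eigenCoord P (a l) i‖ := by
        simp only [← hag, map_sum, eigenCoord_mulVec hP (hL _), Finset.sum_apply, Pi.mul_apply]
    _ ≤ ∑ l, ‖ev l i‖ := norm_sum_le_of_le _ fun l _ => by
        rw [norm_mul]
        exact mul_le_of_le_one_right (norm_nonneg _) (mem_eigenPolydisc.1 (ha l) i)

theorem mem_image_mulVec_eigenPolydisc {P : Matrix ι ι ℂ} (hP : IsUnit P) {s : ι → ℝ}
    {M N : Matrix ι ι ℝ} (hM : M.map Complex.ofReal = P * diagonal (fun i => (s i : ℂ)) * P⁻¹)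
    (hN : N.map Complex.ofReal = P * diagonal (fun i => (s i : ℂ)⁻¹) * P⁻¹) {y : ι → ℝ}
    (hy : ∀ i, ‖eigenCoord P y i‖ ≤ s i) : y ∈ M.mulVec '' eigenPolydisc P := by
  refine ⟨N *ᵥ y, mem_eigenPolydisc.2 fun i => ?_, eigenCoord_injective hP (funext fun i => ?_)⟩
  · have hs : 0 ≤ s i := (norm_nonneg _).trans (hy i)
    rw [eigenCoord_mulVec hP hN, Pi.mul_apply, norm_mul, norm_inv, Complex.norm_of_nonneg hs,
      mul_comm, ← div_eq_mul_inv]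
    exact div_le_one_of_le₀ (hy i) hs
  · rw [eigenCoord_mulVec hP hM, eigenCoord_mulVec hP hN, Pi.mul_apply, Pi.mul_apply]
    -- Where `s i = 0`, the convention `0⁻¹ = 0` makes `N` a pseudo-inverse of `M`.
    rcases eq_or_ne (s i) 0 with hs | hs
    · have hyi : eigenCoord P y i = 0 := norm_le_zero_iff.1 (hs ▸ hy i)
      simp [hyi]
    · exact mul_inv_cancel_left₀ (Complex.ofReal_ne_zero.2 hs) _

theorem volume_sum_image_eigenPolydisc_le [Fintype κ] {P : Matrix ι ι ℂ} (hP : IsUnit P)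
    {L : κ → Matrix ι ι ℝ} {ev : κ → ι → ℂ}
    (hL : ∀ l, (L l).map Complex.ofReal = P * diagonal (ev l) * P⁻¹) :
    volume (∑ l, (L l).mulVec '' eigenPolydisc P) ≤
      (∏ i, ∑ l, ‖ev l i‖ₑ) * volume (eigenPolydisc P) := by
  obtain ⟨M, hM⟩ := exists_real_map_ofReal_eq hP hL
    (f := fun v => ((∑ l, ‖v l‖ : ℝ) : ℂ)) fun v => by simp
  obtain ⟨N, hN⟩ := exists_real_map_ofReal_eq hP hL
    (f := fun v => ((∑ l, ‖v l‖ : ℝ) : ℂ)⁻¹) fun v => by simp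
  have hdet : M.det = ∏ i, ∑ l, ‖ev l i‖ := by
    exact_mod_cast det_eq_prod_of_map_ofReal_eq hP hM
  calc volume (∑ l, (L l).mulVec '' eigenPolydisc P) ≤ volume (M.mulVec '' eigenPolydisc P) :=
        measure_mono fun y hy =>
          mem_image_mulVec_eigenPolydisc hP hM hN (norm_eigenCoord_sum_le hP hL hy)
    _ = (∏ i, ∑ l, ‖ev l i‖ₑ) * volume (eigenPolydisc P) := by
        rw [volume_image_mulVec, hdet, Real.enorm_of_nonneg (by positivity), ofReal_prod_sum_norm]

end Equality

theorem theorem3p1 {k d : ℕ} (L : Fin k → Matrix (Fin d) (Fin d) ℝ) (ev : Fin k → Fin d → ℂ)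
    (hL : SimultaneouslyDiagonalisableInto L ev) :
    (∀ A : Set (Fin d → ℝ), IsCompact A →
      ENNReal.ofReal (∏ i, ∑ l, ‖ev l i‖) * volume A ≤ volume (sumOfImages L A)) ∧
    ∃ A : Set (Fin d → ℝ), IsCompact A ∧ 0 < volume A ∧
      volume (sumOfImages L A) = ENNReal.ofReal (∏ i, ∑ l, ‖ev l i‖) * volume A := by
  obtain ⟨P, hP, hdiag⟩ := hL
  have hPdet : IsUnit P.det := (Matrix.isUnit_iff_isUnit_det P).1 hP
  have hL (l : Fin k) : (L l).map Complex.ofReal = P * Matrix.diagonal (ev l) * P⁻¹ := by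
    rw [← hdiag, ← mul_assoc, Matrix.mul_nonsing_inv_cancel_right _ _ hPdet,
      Matrix.mul_nonsing_inv_cancel_left _ _ hPdet]
  rw [ofReal_prod_sum_norm]
  have hexpand := sumExpands_mulVec hP hL
  have hcompact := isCompact_eigenPolydisc hP
  exact ⟨hexpand, eigenPolydisc P, hcompact, volume_eigenPolydisc_pos P,
    (volume_sum_image_eigenPolydisc_le hP hL).antisymm (hexpand _ hcompact)⟩
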